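/- Let $G$ be a connected linear Lie group, i.e. a connected closed subgroup of $GL_n(\mathbb C)$, with Lie algebra $\mathfrak g=\{X\in M_n(\mathbb C):\exp(tX)\in G\ \text{for all } t\in\mathbb R\}$, and let $g_1,\dots,g_{D}$ be a basis of $\mathfrak g$ over $\mathbb R$. Let $\mathbb K=\mathbb R$ or $\mathbb C$, let $\mathbb F$ be a $\mathbb K$-vector space, and let $G$ act on a set $\Omega$. Let $\mathcal L$ be an index set and, for each $l\in\mathcal L$, let $\mathcal M_l$ be a finite index set and $\phi^l_m:\Omega\to\mathbb F$, $m\in\mathcal M_l$, be functions in a $\mathbb K$-vector space of functions with a scalar product (positive semidefiniteness is enough) such that $\langle\phi^l_m,\phi^{l'}_{m'}\rangle=\delta_{ll'}\delta_{mm'}$. Assume that each $V^l=\mathrm{Span}\{\phi^l_m: m\in\mathcal M_l\}$ is stable under $f\mapsto f(g\,\cdot)$, $g\in G$, and let $\rho^l$ be the representation of $G$ given by $\phi^l_m(g\cdot r)=\sum_{m'\in\mathcal M_l}\rho^l_{m,m'}(g)\,\phi^l_{m'}(r)$; assume that each $\rho^l$ is continuous. Then the derivatives $$\varrho^{l,d}_{m,m'}=\frac{d}{dt}\Big|_{t=0}\rho^l_{m,m'}(\exp(t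 g_d))$$ exist. Let $\boldsymbol l=(l_1,\dots,l_N)\in\mathcal L^N$ and $L\in\mathcal L$. Put $\mathcal M_{\boldsymbol l}=\prod_i\mathcal M_{l_i}$ and $\phi^{\boldsymbol l}_{\boldsymbol m}(r_1,\dots,r_N)=\phi^{l_1}_{m_1}(r_1)\otimes\cdots\otimes\phi^{l_N}_{m_N}(r_N)$, with values in the $N$-th tensor power $\mathbb F^{\otimes N}$ over $\mathbb K$ (the ordinary product if $\mathbb F=\mathbb K$), and let $V^{\boldsymbol l}=\bigotimes_i V^{l_i}$ be the space of functions on $\Omega^N$ spanned by the products $f_1(r_1)\otimes\cdots\otimes f_N(r_N)$ with $f_i\in V^{l_i}$. Let $V^{\boldsymbol l,L}$ be the space of the functions $F=[F_k]_{k\in\mathcal M_L}\in[V^{\boldsymbol l}]^{|\mathcal M_L|}$ such that $F(g\cdot R)=\rho^L(g)F(R)$ for all $g\in G$ and $R\in\Omega^N$, where $g\cdot(r_1,\dots,r_N)=(g\cdot r_1,\dots,g\cdot r_N)$. Let $M^{\boldsymbol l,L}$ be the matrix obtained by stacking $M_1,\dots,M_D$, where, for $(\boldsymbol m,k),(\boldsymbol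 m',k')\in\mathcal M_{\boldsymbol l}\times\mathcal M_L$, $$M_d[(\boldsymbol m,k),(\boldsymbol m',k')]=\begin{cases}\sum_{j=1}^N\varrho^{l_j,d}_{m_j,m_j}-\varrho^{L,d}_{k,k}&\text{if }\boldsymbol m=\boldsymbol m',\ k=k',\\-\varrho^{L,d}_{k,k'}&\text{if }\boldsymbol m=\boldsymbol m',\ k\neq k',\\ \varrho^{l_j,d}_{m'_j,m_j}&\text{if } m_j\ne m'_j,\ m_s=m'_s \text{ for all } s\neq j,\ k=k',\\0&\text{otherwise.}\end{cases}$$ Then: (1) For $c\in\mathbb K^{\mathcal M_{\boldsymbol l}\times\mathcal M_L}$, the function $\big[\sum_{\boldsymbol m\in\mathcal M_{\boldsymbol l}}c_{\boldsymbol m,k}\,\phi^{\boldsymbol l}_{\boldsymbol m}\big]_{k\in\mathcal M_L}$ belongs to $V^{\boldsymbol l,L}$ if and only if $c\in\ker M^{\boldsymbol l,L}$. (2) If $c_i=\{c_{\boldsymbol m,k,i}\}$, $i=1,\dots,\dim\ker M^{\boldsymbol l,L}$, is a basis of $\ker M^{\boldsymbol l,L}$, then the functions $b_i=\big[\sum_{\boldsymbol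 m\in\mathcal M_{\boldsymbol l}}c_{\boldsymbol m,k,i}\,\phi^{\boldsymbol l}_{\boldsymbol m}\big]_{k\in\mathcal M_L}$ form a basis of $V^{\boldsymbol l,L}$. (3) $\dim V^{\boldsymbol l,L}=\dim\ker M^{\boldsymbol l,L}$. -/

import Mathlib

open scoped TensorProduct

noncomputable section

/-! ### Linear Lie groups: exponential and Lie algebra -/

/-- The exponential of a complex `n × n` matrix, as an element of `GL_n(ℂ)`. -/
def expGL {n : ℕ} (X : Matrix (Fin n) (Fin n) ℂ) : GL (Fin n) ℂ :=
  (Matrix.isUnit_exp X).unit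

/-- A linear Lie group: a subgroup of `GL_n(ℂ)` that is a closed subset of `GL_n(ℂ)`. -/
def IsLinearLieGroup {n : ℕ} (G : Subgroup (GL (Fin n) ℂ)) : Prop :=
  IsClosed (G : Set (GL (Fin n) ℂ))

/-- The Lie algebra `𝔤 = {X ∈ M_n(ℂ) | exp (t X) ∈ G for all real t}` of a linear Lie group. -/
def lieAlgebraOf {n : ℕ} (G : Subgroup (GL (Fin n) ℂ)) : Set (Matrix (Fin n) (Fin n) ℂ) :=
  {X | ∀ t : ℝ, expGL (t • X) ∈ G}

/-- The one-parameter subgroup `t ↦ exp (t X)` of `G` attached to `X ∈ 𝔤`. -/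
def oneParam {n : ℕ} {G : Subgroup (GL (Fin n) ℂ)} (X : lieAlgebraOf G) (t : ℝ) : G :=
  ⟨expGL (t • (X : Matrix (Fin n) (Fin n) ℂ)), X.2 t⟩

/-- `X_1, …, X_D` is a set of generators of the real Lie algebra `𝔤` with `D = dim_ℝ 𝔤` elements,
i.e. a basis of `𝔤` over `ℝ`: the `X_d ∈ 𝔤` are linearly independent over `ℝ` and every element
of `𝔤` is a real linear combination of them. -/
def IsLieAlgebraBasis {n D : ℕ} {G : Subgroup (GL (Fin n) ℂ)} (X : Fin D → lieAlgebraOf G) : Prop :=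
  LinearIndependent ℝ (fun d => (X d : Matrix (Fin n) (Fin n) ℂ)) ∧
    lieAlgebraOf G ⊆
      (Submodule.span ℝ (Set.range fun d => (X d : Matrix (Fin n) (Fin n) ℂ)) :
        Set (Matrix (Fin n) (Fin n) ℂ))

/-- The derivative `dρ(X) = d/dt|_{t = 0} ρ(exp (t X))`, taken entrywise, of a matrix-valued
function `ρ` on `G` in the direction `X ∈ 𝔤`. -/
def lieDeriv {𝕜 : Type*} [RCLike 𝕜] {n : ℕ} {G : Subgroup (GL (Fin n) ℂ)} {κ : Type*}
    (ρ : G → Matrix κ κ 𝕜) (X : lieAlgebraOf G) : Matrix κ κ 𝕜 :=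
  Matrix.of fun a b => deriv (fun t : ℝ => ρ (oneParam X t) a b) 0

/-! ### One-particle functions and compatible bases -/

section OneParticle

variable {G Ω F κ : Type*} (𝕜 : Type*) [SMul G Ω] [Field 𝕜] [AddCommGroup F] [Module 𝕜 F]
  [Fintype κ]

/-- The span of the functions `φ_m : Ω → F` is stable under the group action `f ↦ f (g · )`. -/
def IsGroupStable (G : Type*) [SMul G Ω] (φ : κ → Ω → F) : Prop :=
  ∀ (g : G), ∀ f ∈ Submodule.span 𝕜 (Set.range φ),
    (fun r => f (g • r)) ∈ Submodule.span 𝕜 (Set.range φ)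

/-- The matrices `ρ(g)` of the group action in a (linearly independent, group-stable) family
`φ_m : Ω → F`: the coefficients in `φ_m(g · r) = ∑_{m'} ρ(g)_{m m'} φ_{m'}(r)` for all `r`. -/
def compatibleRep (φ : κ → Ω → F) (g : G) : Matrix κ κ 𝕜 :=
  Matrix.of fun m => Classical.epsilon fun a : κ → 𝕜 =>
    ∀ r : Ω, φ m (g • r) = ∑ m' : κ, a m' • φ m' r

theorem compatibleRep_spec {φ : κ → Ω → F} (h : IsGroupStable 𝕜 G φ) (g : G) (m : κ) (r : Ω) :
    φ m (g • r) = ∑ m' : κ, compatibleRep 𝕜 φ g m m' • φ m' r := by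
  have hm := h g (φ m) (Submodule.subset_span ⟨m, rfl⟩)
  obtain ⟨a, ha⟩ := (Submodule.mem_span_range_iff_exists_fun 𝕜).1 hm
  have hex : ∃ a : κ → 𝕜, ∀ r : Ω, φ m (g • r) = ∑ m' : κ, a m' • φ m' r := by
    refine ⟨a, fun r => ?_⟩
    have := congrFun ha r
    simpa [Finset.sum_apply] using this.symm
  exact Classical.epsilon_spec hex r

end OneParticle

/-- The functions `φ^l_m`, for all `l` and `m`, are orthonormal for the scalar product `ip` on the
function space `H`. (`ip` need only be positive semidefinite, as the `L²` product is
on square-integrable functions that are not identified almost everywhere.) -/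
def IsOrthonormalFamily {𝕜 Ω F ℒ : Type*} [RCLike 𝕜] [AddCommGroup F] [Module 𝕜 F]
    {M : ℒ → Type*} {H : Submodule 𝕜 (Ω → F)} (ip : PreInnerProductSpace.Core 𝕜 H)
    (φ : ∀ l, M l → H) : Prop :=
  (∀ l m, ip.inner (φ l m) (φ l m) = 1) ∧
    ∀ l l' m m', (⟨l, m⟩ : Σ l, M l) ≠ ⟨l', m'⟩ → ip.inner (φ l m) (φ l' m') = 0

/-! ### Tensor powers and the `N`-particle space -/

section Tensor

variable {𝕜 : Type*} [Field 𝕜] {N : ℕ} {F E : Type*} [AddCommGroup F] [Module 𝕜 F]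
  [AddCommGroup E] [Module 𝕜 E]

/-- `E`, with the multilinear map `τ (v_1, …, v_N) = v_1 ⊗ ⋯ ⊗ v_N`, is an `N`-th tensor power
of `F` over `𝕜`: the canonical map to `E` from `⨂_i F` is an isomorphism. -/
def IsTensorPower (τ : MultilinearMap 𝕜 (fun _ : Fin N => F) E) : Prop :=
  Function.Bijective (PiTensorProduct.lift τ)

/-- The `N`-fold tensor power of `F` is a tensor power. -/
theorem isTensorPower_tprod :
    IsTensorPower (PiTensorProduct.tprod 𝕜 : MultilinearMap 𝕜 (fun _ : Fin N => F) _) := by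
  unfold IsTensorPower
  rw [PiTensorProduct.lift_tprod]
  exact Function.bijective_id

/-- For `F = 𝕜`, the field `𝕜` with the ordinary product `v_1 ⋯ v_N` is a tensor power. -/
theorem isTensorPower_mul : IsTensorPower (MultilinearMap.mkPiAlgebra 𝕜 (Fin N) 𝕜) :=
  (PiTensorProduct.constantBaseRingEquiv (Fin N) 𝕜).bijective

variable {Ω ℒ : Type*} {M : ℒ → Type*}

/-- The function `R = (r_1, …, r_N) ↦ f_1(r_1) ⊗ ⋯ ⊗ f_N(r_N)`. -/
def tensorFun (τ : MultilinearMap 𝕜 (fun _ : Fin N => F) E) (f : Fin N → Ω → F) :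
    (Fin N → Ω) → E :=
  fun R => τ fun i => f i (R i)

/-- The tensor product space `V^𝐥 = ⨂_i V^{l_i}` of `N`-particle functions `Ω^N → E`, where
`V^l` is the span of the functions `φ^l_m`. -/
def tensorSpace (τ : MultilinearMap 𝕜 (fun _ : Fin N => F) E) (φ : ∀ l, M l → Ω → F)
    (l : Fin N → ℒ) : Submodule 𝕜 ((Fin N → Ω) → E) :=
  Submodule.span 𝕜 {u | ∃ f : Fin N → Ω → F,
    (∀ i, f i ∈ Submodule.span 𝕜 (Set.range (φ (l i)))) ∧ u = tensorFun τ f}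

variable {G κ : Type*} [SMul G Ω] [Fintype κ]

/-- `F : Ω^N → E^κ` is group-equivariant for `ρ`: `F(g · R) = ρ(g) F(R)`. -/
def IsGroupEquivariant (ρ : G → Matrix κ κ 𝕜) (u : (Fin N → Ω) → κ → E) : Prop :=
  ∀ (g : G) (R : Fin N → Ω) (k : κ),
    u (fun i => g • R i) k = ∑ k', ρ g k k' • u R k'

/-- The space `V^{𝐥,L}` of the functions in `[V^𝐥]^κ` (`κ = M_L`) that are group-equivariant
for `ρ` (`= ρ^L`). -/
def geSpace (τ : MultilinearMap 𝕜 (fun _ : Fin N => F) E) (φ : ∀ l, M l → Ω → F)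
    (l : Fin N → ℒ) (ρ : G → Matrix κ κ 𝕜) : Submodule 𝕜 ((Fin N → Ω) → κ → E) where
  carrier := {u | (∀ k, (fun R => u R k) ∈ tensorSpace τ φ l) ∧ IsGroupEquivariant ρ u}
  zero_mem' := ⟨fun _ => Submodule.zero_mem _, fun g R k => by simp⟩
  add_mem' := by
    rintro u v ⟨hu, hu'⟩ ⟨hv, hv'⟩
    refine ⟨fun k => Submodule.add_mem _ (hu k) (hv k), fun g R k => ?_⟩
    simp [hu' g R k, hv' g R k, Finset.sum_add_distrib]
  smul_mem' := by
    rintro a u ⟨hu, hu'⟩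
    refine ⟨fun k => Submodule.smul_mem _ a (hu k), fun g R k => ?_⟩
    simp [hu' g R k, Finset.smul_sum, smul_comm a]

variable [∀ l, Fintype (M l)]

/-- The function `[∑_𝐦 c_{𝐦,k} φ^𝐥_𝐦]_k` with coefficients `c`, where
`φ^𝐥_𝐦(R) = φ^{l_1}_{m_1}(r_1) ⊗ ⋯ ⊗ φ^{l_N}_{m_N}(r_N)`. -/
def coupledFun (τ : MultilinearMap 𝕜 (fun _ : Fin N => F) E) (φ : ∀ l, M l → Ω → F)
    (l : Fin N → ℒ) (c : (∀ i, M (l i)) × κ → 𝕜) : (Fin N → Ω) → κ → E :=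
  fun R k => ∑ m : ∀ i, M (l i), c (m, k) • tensorFun τ (fun i => φ (l i) (m i)) R

end Tensor

/-! ### The matrix `M^{𝐥,L}` -/

section CouplingMatrix

variable {𝕜 : Type*} [Field 𝕜] {N D : ℕ} {ℒ : Type*} {M : ℒ → Type*} [∀ l, DecidableEq (M l)]

/-- The submatrix `M_d`, for given matrices `A l = dρ^l(X_d)`. In the third case, the index `j` at
which `𝐦` and `𝐦'` differ is unique if it exists, so the sum has at most one nonzero term; it is
`0` if there is no such index. -/
def couplingBlock (A : ∀ l, Matrix (M l) (M l) 𝕜) (l : Fin N → ℒ) (L : ℒ) :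
    Matrix ((∀ i, M (l i)) × M L) ((∀ i, M (l i)) × M L) 𝕜 :=
  Matrix.of fun p q =>
    if p.1 = q.1 ∧ p.2 = q.2 then ∑ j, A (l j) (p.1 j) (p.1 j) - A L p.2 p.2
    else if p.1 = q.1 ∧ p.2 ≠ q.2 then -A L p.2 q.2
    else ∑ j, if (∀ s, s ≠ j → p.1 s = q.1 s) ∧ p.1 j ≠ q.1 j ∧ p.2 = q.2 then
      A (l j) (q.1 j) (p.1 j) else 0

/-- The stacked matrix `M^{𝐥,L}` with blocks of rows `M_1, …, M_D`, where `A d l = dρ^l(X_d)`. -/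
def couplingMatrix (A : Fin D → ∀ l, Matrix (M l) (M l) 𝕜) (l : Fin N → ℒ) (L : ℒ) :
    Matrix (Fin D × ((∀ i, M (l i)) × M L)) ((∀ i, M (l i)) × M L) 𝕜 :=
  Matrix.of fun p q => couplingBlock (A p.1) l L p.2 q

end CouplingMatrix

end

/-! The functions $\phi^{\boldsymbol l}_{\boldsymbol m}$ are linearly independent, so a function in
$[V^{\boldsymbol l}]^{|\mathcal M_L|}$ is the same thing as its coefficient matrix $C$
(`coupledLinearMap_injective`, `exists_coupledFun_eq`). Orthonormality serves only to make the
one-particle functions independent. Equivariance under $g$ then reads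
$C\,\bigotimes_i\rho^{l_i}(g)=\rho^L(g)\,C$ (`isGroupEquivariant_coupledFun_iff`), and the $g$ that
satisfy this form a subgroup.

On $g=\exp(tX_d)$ the condition says that $\mathrm{vec}\,C$ is fixed by the one-parameter group
$(\bigotimes_i\rho^{l_i}(t))^{T}\otimes\rho^L(-t)$. Its derivative at $0$ is exactly $M_d$, and a
vector is fixed if and only if this derivative kills it
(`forall_intertwine_iff_couplingBlock_mulVec_eq_zero`). Continuity of $\rho^l$ is enough for the
derivatives to exist.

Hence $c\in\ker M^{\boldsymbol l,L}$ if and only if the subgroup contains every $\exp(tX_d)$. These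
elements generate the connected closed group $G$ (`eq_top_of_oneParam_mem`), by the closed-subgroup
argument, so the infinitesimal condition is the full one. -/

/-! ### Generation of a connected linear Lie group by one-parameter subgroups -/

section LinearLieGroups

open Filter Topology NormedSpace

section SecondKind

variable {R : Type*} [NormedRing R] [NormedAlgebra ℝ R]

/-- Every factor is `1` at `x`, so the left and right multipliers in the noncommutative product rule
disappear and the derivatives simply add. -/
theorem HasStrictFDerivAt.list_prod_of_eq_one {V : Type*} [NormedAddCommGroup V]
    [NormedSpace ℝ V] {ι : Type*} {f : ι → V → R}
    {f' : ι → V →L[ℝ] R} {x : V} (hf : ∀ i, HasStrictFDerivAt (f i) (f' i) x)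
    (h1 : ∀ i, f i x = 1) (s : List ι) :
    HasStrictFDerivAt (fun y => (s.map fun i => f i y).prod) (s.map f').sum x := by
  induction s with
  | nil => simpa using hasStrictFDerivAt_const (1 : R) x
  | cons i s ih =>
    have hprod : (s.map fun i => f i x).prod = 1 := by simp [h1]
    have h := (hf i).mul' ih
    rw [hprod, h1, MulOpposite.op_one, one_smul, one_smul, add_comm] at h
    simp only [List.map_cons, List.prod_cons, List.sum_cons]
    exact h

/-- Coordinates of the second kind: near `1`, every element is a product
`exp (a_1 x_1) ⋯ exp (a_D x_D) exp Z` with a small `Z` in a given complement of the span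
of the `x_d`. -/
theorem eventually_eq_prod_exp_mul_exp [FiniteDimensional ℝ R] {D : ℕ} {x : Fin D → R}
    (hli : LinearIndependent ℝ x) {W : Submodule ℝ R}
    (hW : IsCompl (Submodule.span ℝ (Set.range x)) W) {p : R → Prop} (hp : ∀ᶠ Z in 𝓝 0, p Z) :
    ∀ᶠ y in 𝓝 (1 : R), ∃ a : Fin D → ℝ, ∃ Z ∈ W, p Z ∧
      y = ((List.finRange D).map fun d => exp (a d • x d)).prod * exp Z := by
  have : CompleteSpace R := FiniteDimensional.complete ℝ R
  set U := Submodule.span ℝ (Set.range x) with hU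
  let B : Module.Basis (Fin D) ℝ U := Module.Basis.span hli
  let π : R →ₗ[ℝ] U := U.projectionOnto W hW
  let a : Fin D → R →L[ℝ] ℝ := fun d => (B.coord d ∘ₗ π).toContinuousLinearMap
  let Q : R →L[ℝ] R := (LinearMap.id - U.subtype ∘ₗ π).toContinuousLinearMap
  have hQ : ∀ A, Q A = A - π A := fun A => rfl
  have hQW : ∀ A, Q A ∈ W := fun A => by
    rw [← Submodule.projectionOnto_apply_eq_zero_iff hW, hQ, map_sub,
      Submodule.projectionOnto_apply_left, sub_self]
  let e : Fin D → R →L[ℝ] R := fun d => (a d).smulRight (x d)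
  -- The coordinate maps `e d` add up to the projection onto `U`, and `Q` is the complementary
  -- projection. Their sum is the derivative at `0` of the product of exponentials.
  have hsum : Q + ((List.finRange D).map e).sum = ContinuousLinearMap.id ℝ R := by
    have h1 : ∀ A, ∑ d, e d A = π A := fun A => by
      have := congrArg U.subtype (B.sum_repr (π A))
      rw [map_sum] at this
      refine Eq.trans (Finset.sum_congr rfl fun d _ => ?_) this
      rw [map_smul, Submodule.subtype_apply, Module.Basis.span_apply]
      rfl
    rw [← List.ofFn_eq_map, List.sum_ofFn]
    ext A
    simp [h1, hQ]
  have hexp : ∀ T : R →L[ℝ] R, HasStrictFDerivAt (fun A => exp (T A)) T 0 := fun T => by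
    have h : HasStrictFDerivAt (exp : R → R) (1 : R →L[ℝ] R) (T 0) := by
      rw [map_zero]; exact hasStrictFDerivAt_exp_zero
    exact h.comp 0 T.hasStrictFDerivAt
  have hΦ := (HasStrictFDerivAt.list_prod_of_eq_one (fun d => hexp (e d)) (by simp)
    (List.finRange D)).mul' (hexp Q)
  have h1 : ((List.finRange D).map fun d => exp (e d 0)).prod = 1 := by simp
  rw [h1, map_zero, exp_zero, MulOpposite.op_one, one_smul, one_smul, hsum,
    ← ContinuousLinearEquiv.coe_refl] at hΦ
  -- Inverse function theorem: the derivative is the identity, so the map carries the neighbourhoods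
  -- of `0` onto those of `1`.
  have hmap := hΦ.map_nhds_eq_of_equiv
  rw [Pi.mul_apply, h1, map_zero, exp_zero, mul_one] at hmap
  have hQ0 : Tendsto Q (𝓝 0) (𝓝 0) := by simpa using Q.continuous.tendsto 0
  rw [← hmap, eventually_map]
  filter_upwards [hQ0.eventually hp] with A hA
  exact ⟨fun d => a d A, Q A, hQW A, hA, rfl⟩

end SecondKind

/-! ### Exponentials, one-parameter subgroups and the closed-subgroup argument -/

variable {n D : ℕ}

@[simp]
theorem coe_expGL (X : Matrix (Fin n) (Fin n) ℂ) :
    ((expGL X : GL (Fin n) ℂ) : Matrix (Fin n) (Fin n) ℂ) = exp X :=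
  IsUnit.unit_spec _

theorem expGL_add_of_commute {X Y : Matrix (Fin n) (Fin n) ℂ} (h : Commute X Y) :
    expGL (X + Y) = expGL X * expGL Y := by
  ext1
  simp [Matrix.exp_add_of_commute X Y h]

@[simp]
theorem expGL_zero : expGL (0 : Matrix (Fin n) (Fin n) ℂ) = 1 := by
  ext1
  simp

theorem expGL_neg (X : Matrix (Fin n) (Fin n) ℂ) : expGL (-X) = (expGL X)⁻¹ := by
  rw [eq_inv_iff_mul_eq_one, ← expGL_add_of_commute (Commute.refl X).neg_left, neg_add_cancel,
    expGL_zero]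

theorem expGL_zsmul (z : ℤ) (X : Matrix (Fin n) (Fin n) ℂ) : expGL (z • X) = expGL X ^ z := by
  ext1
  rw [coe_expGL, Matrix.exp_zsmul, Matrix.coe_units_zpow, coe_expGL]

open scoped Matrix.Norms.Operator in
theorem continuous_expGL : Continuous (expGL : Matrix (Fin n) (Fin n) ℂ → GL (Fin n) ℂ) := by
  have h : Continuous fun X : Matrix (Fin n) (Fin n) ℂ => exp X := exp_continuous
  rw [Units.continuous_iff]
  constructor
  · simp only [Function.comp_def, coe_expGL]
    exact h
  · simp only [← expGL_neg, coe_expGL]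
    exact h.comp continuous_neg

variable {G : Subgroup (GL (Fin n) ℂ)}

theorem oneParam_zero (X : lieAlgebraOf G) : oneParam X 0 = 1 :=
  Subtype.ext (by simp [oneParam])

theorem oneParam_add (X : lieAlgebraOf G) (s t : ℝ) :
    oneParam X (s + t) = oneParam X s * oneParam X t :=
  Subtype.ext <| by
    simp only [oneParam, add_smul, Subgroup.coe_mul]
    exact expGL_add_of_commute (((Commute.refl _).smul_left s).smul_right t)

theorem continuous_oneParam (X : lieAlgebraOf G) : Continuous (oneParam X) :=
  (continuous_expGL.comp (by fun_prop)).subtype_mk _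

open scoped Matrix.Norms.Operator in
/-- If `exp Z_k ∈ G` for nonzero `Z_k → 0` with directions `Z_k / ‖Z_k‖ → Z`, and `G` is closed,
then `Z` is in the Lie algebra of `G`. -/
theorem mem_lieAlgebraOf_of_tendsto (hG : IsLinearLieGroup G)
    {Z : ℕ → Matrix (Fin n) (Fin n) ℂ} {Z₀ : Matrix (Fin n) (Fin n) ℂ} (hZG : ∀ k, expGL (Z k) ∈ G)
    (hZ0 : ∀ k, Z k ≠ 0) (hZ : Tendsto Z atTop (𝓝 0))
    (hdir : Tendsto (fun k => ‖Z k‖⁻¹ • Z k) atTop (𝓝 Z₀)) : Z₀ ∈ lieAlgebraOf G := by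
  intro t
  -- Rounding `t / ‖Z k‖` down to an integer costs at most `‖Z k‖` after rescaling. Integer
  -- multiples are needed because only integer powers of `expGL (Z k)` are known to lie in `G`.
  have hfloor : Tendsto (fun k => (⌊t * ‖Z k‖⁻¹⌋ : ℝ) * ‖Z k‖) atTop (𝓝 t) := by
    have hn : Tendsto (fun k => ‖Z k‖) atTop (𝓝 0) := by simpa using hZ.norm
    have hlow : Tendsto (fun k => t - ‖Z k‖) atTop (𝓝 t) := by
      simpa using hn.const_sub t
    refine tendsto_of_tendsto_of_tendsto_of_le_of_le hlow tendsto_const_nhds (fun k => ?_)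
      fun k => ?_
    · have hp : 0 < ‖Z k‖ := norm_pos_iff.2 (hZ0 k)
      have := mul_le_mul_of_nonneg_right (Int.lt_floor_add_one (t * ‖Z k‖⁻¹)).le hp.le
      rw [inv_mul_cancel_right₀ hp.ne'] at this
      change t - ‖Z k‖ ≤ _
      linarith
    · have hp : 0 < ‖Z k‖ := norm_pos_iff.2 (hZ0 k)
      have := mul_le_mul_of_nonneg_right (Int.floor_le (t * ‖Z k‖⁻¹)) hp.le
      rwa [inv_mul_cancel_right₀ hp.ne'] at this
  have hlim : Tendsto (fun k => ⌊t * ‖Z k‖⁻¹⌋ • Z k) atTop (𝓝 (t • Z₀)) := by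
    refine (hfloor.smul hdir).congr fun k => ?_
    rw [smul_smul, mul_inv_cancel_right₀ (norm_ne_zero_iff.2 (hZ0 k)), Int.cast_smul_eq_zsmul]
  refine hG.mem_of_tendsto ((continuous_expGL.tendsto _).comp hlim) (Eventually.of_forall fun k => ?_)
  simp only [Function.comp_apply, expGL_zsmul]
  exact G.zpow_mem (hZG k) _

open scoped Matrix.Norms.Operator in
/-- In a real subspace that meets the Lie algebra of a closed group `G` only in `0`, the only small
`Z` with `exp Z ∈ G` is `0`. -/
theorem eventually_eq_zero_of_expGL_mem (hG : IsLinearLieGroup G)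
    (W : Submodule ℝ (Matrix (Fin n) (Fin n) ℂ)) (hW : ∀ Z ∈ W, Z ∈ lieAlgebraOf G → Z = 0) :
    ∀ᶠ Z in 𝓝 (0 : Matrix (Fin n) (Fin n) ℂ), Z ∈ W → expGL Z ∈ G → Z = 0 := by
  by_contra hcon
  rw [not_eventually] at hcon
  have : (𝓝 (0 : Matrix (Fin n) (Fin n) ℂ)).IsCountablyGenerated :=
    inferInstanceAs (@nhds (Fin n → Fin n → ℂ) _ 0).IsCountablyGenerated
  obtain ⟨Z, hZ, hZp⟩ := exists_seq_forall_of_frequently hcon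
  push Not at hZp
  -- Compactness of the unit sphere gives a limit direction, which lies in `W` and in the Lie
  -- algebra. It would have to be `0` although its norm is `1`.
  have hsph : ∀ k, ‖Z k‖⁻¹ • Z k ∈ Metric.sphere (0 : Matrix (Fin n) (Fin n) ℂ) 1 := fun k => by
    rw [mem_sphere_zero_iff_norm, norm_smul, norm_inv, norm_norm,
      inv_mul_cancel₀ (norm_ne_zero_iff.2 (hZp k).2.2)]
  have : ProperSpace (Matrix (Fin n) (Fin n) ℂ) := FiniteDimensional.proper_rclike ℂ _
  obtain ⟨Z₀, hZ₀, s, hs, hlim⟩ := (isCompact_sphere _ _).tendsto_subseq hsph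
  have hZ₀W : Z₀ ∈ W := W.closed_of_finiteDimensional.mem_of_tendsto hlim
    (Eventually.of_forall fun k => W.smul_mem _ (hZp (s k)).1)
  have hZ₀G : Z₀ ∈ lieAlgebraOf G := mem_lieAlgebraOf_of_tendsto hG (Z := Z ∘ s)
    (fun k => (hZp (s k)).2.1) (fun k => (hZp (s k)).2.2) (hZ.comp hs.tendsto_atTop) hlim
  have := hW Z₀ hZ₀W hZ₀G
  simp [this] at hZ₀

open scoped Matrix.Norms.Operator in
/-- A connected linear Lie group is generated by the one-parameter subgroups attached to a basis
of its Lie algebra. -/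
theorem eq_top_of_oneParam_mem (hG : IsLinearLieGroup G)
    (hconn : IsConnected (G : Set (GL (Fin n) ℂ))) {X : Fin D → lieAlgebraOf G}
    (hX : IsLieAlgebraBasis X) (S : Subgroup G) (hS : ∀ d t, oneParam (X d) t ∈ S) : S = ⊤ := by
  obtain ⟨hli, hspan⟩ := hX
  obtain ⟨W, hW⟩ :=
    (Submodule.span ℝ (Set.range fun d => (X d : Matrix (Fin n) (Fin n) ℂ))).exists_isCompl
  have hzero := eventually_eq_zero_of_expGL_mem hG W fun Z hZW hZG =>
    Submodule.disjoint_def.1 hW.disjoint Z (hspan hZG) hZW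
  have hval : Tendsto (fun g : G => ((g : GL (Fin n) ℂ) : Matrix (Fin n) (Fin n) ℂ)) (𝓝 1) (𝓝 1) :=
    (Units.continuous_val.comp continuous_subtype_val).tendsto (1 : G)
  -- Near `1`, write `g = s * expGL Z` with `s ∈ S` and `Z` small in the complement `W`. Then `expGL
  -- Z = s⁻¹ * g` is in `G`, which forces `Z = 0`.
  have hSnhds : (S : Set G) ∈ 𝓝 1 := by
    filter_upwards [hval.eventually (eventually_eq_prod_exp_mul_exp hli hW hzero)] with g hg
    obtain ⟨a, Z, hZW, hZ, hg⟩ := hg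
    let s : G := ((List.finRange D).map fun d => oneParam (X d) (a d)).prod
    have hs : s ∈ S := S.list_prod_mem fun y hy => by
      obtain ⟨d, -, rfl⟩ := List.mem_map.1 hy
      exact hS d _
    have hgs : (g : GL (Fin n) ℂ) = (s : GL (Fin n) ℂ) * expGL Z := by
      ext1
      rw [hg, Units.val_mul, coe_expGL]
      congr 1
      change _ = ((Units.coeHom _).comp G.subtype) s
      rw [map_list_prod, List.map_map]
      congr 1
    have hZG : expGL Z ∈ G := by
      rw [← inv_mul_eq_iff_eq_mul.2 hgs]
      exact G.mul_mem (G.inv_mem s.2) g.2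
    have hgs' : g = s := Subtype.ext (by rw [hgs, hZ hZW hZG, expGL_zero, mul_one])
    exact hgs' ▸ hs
  -- An open subgroup is also closed, so it is everything in a connected group.
  have hopen : IsOpen (S : Set G) := S.isOpen_of_mem_nhds hSnhds
  have : ConnectedSpace G := isConnected_iff_connectedSpace.1 hconn
  exact SetLike.coe_injective
    (IsClopen.eq_univ ⟨S.isClosed_of_isOpen hopen, hopen⟩ ⟨1, S.one_mem⟩)

end LinearLieGroups

/-! ### Linear independence of tensor products of functions -/

section TensorFunctions

/-- Pairing a vanishing combination with `φ l i` isolates the coefficient at `i`. Definiteness of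
the scalar product plays no role. -/
theorem IsOrthonormalFamily.linearIndependent {𝕜 Ω F ℒ : Type*} [RCLike 𝕜] [AddCommGroup F]
    [Module 𝕜 F] {M : ℒ → Type*} {H : Submodule 𝕜 (Ω → F)} {ip : PreInnerProductSpace.Core 𝕜 H}
    {φ : ∀ l, M l → H} (hφ : IsOrthonormalFamily ip φ) (l : ℒ) :
    LinearIndependent 𝕜 fun m => (φ l m : Ω → F) := by
  suffices h : LinearIndependent 𝕜 (φ l) from h.map' H.subtype (Submodule.ker_subtype H)
  classical
  let _ := ip
  rw [linearIndependent_iff']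
  intro s a ha i hi
  let T : H →+ 𝕜 :=
    { toFun := fun v => ip.inner (φ l i) v
      map_zero' := InnerProductSpace.Core.inner_zero_right _
      map_add' := fun v w => InnerProductSpace.Core.inner_add_right _ _ _ }
  have hT : ∀ (b : 𝕜) v, T (b • v) = b * T v := fun b v =>
    InnerProductSpace.Core.inner_smul_right _ _
  have hTi : ∀ j, T (φ l j) = if j = i then 1 else 0 := fun j => by
    split_ifs with h
    · subst h; exact hφ.1 l j
    · exact hφ.2 l l i j (by simpa using Ne.symm h)
  have := congrArg T ha
  simpa [map_sum, hT, hTi, hi] using this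

variable {𝕜 : Type*} [Field 𝕜] {N : ℕ} {Ω F E : Type*} [AddCommGroup F] [Module 𝕜 F]
  [AddCommGroup E] [Module 𝕜 E]

/-- The vectors `(λ (f_m (r)))_m`, for `r ∈ Ω` and functionals `λ`, span the coordinate space if
the functions `f_m` are linearly independent. -/
theorem LinearIndependent.span_range_dual_eval_eq_top {κ : Type*} [Fintype κ] {f : κ → Ω → F}
    (hf : LinearIndependent 𝕜 f) :
    Submodule.span 𝕜 (Set.range fun p : Ω × Module.Dual 𝕜 F => fun m => p.2 (f m p.1)) = ⊤ := by
  classical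
  by_contra hne
  obtain ⟨T, hT0, hT⟩ := Submodule.exists_le_ker_of_lt_top _ (lt_top_iff_ne_top.2 hne)
  apply hT0
  have hTv : ∀ v, T v = ∑ m, T (Pi.single m 1) * v m := fun v => by
    conv_lhs => rw [pi_eq_sum_univ' v]
    simp [map_sum, mul_comm]
  -- A functional that kills all the vectors is a linear relation among the `f m`, because
  -- functionals separate the points of `F`.
  have hsum : ∑ m, T (Pi.single m 1) • f m = 0 := by
    funext r
    refine (Module.forall_dual_apply_eq_zero_iff 𝕜 _).1 fun d => ?_
    have := hT (Submodule.subset_span ⟨(r, d), rfl⟩)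
    rw [LinearMap.mem_ker, hTv] at this
    simpa [Finset.sum_apply, map_sum] using this
  have h0 := Fintype.linearIndependent_iff.1 hf _ hsum
  ext m
  simpa using h0 m

variable {ℒ : Type*} {M : ℒ → Type*} [∀ l, Fintype (M l)]

/-- Tensor products of linearly independent functions are linearly independent. -/
theorem linearIndependent_tensorFun {τ : MultilinearMap 𝕜 (fun _ : Fin N => F) E}
    (hτ : IsTensorPower τ) {φ : ∀ l, M l → Ω → F} (hφ : ∀ l, LinearIndependent 𝕜 (φ l))
    (l : Fin N → ℒ) :
    LinearIndependent 𝕜 fun m : ∀ i, M (l i) => tensorFun τ fun i => φ (l i) (m i) := by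
  classical
  rw [Fintype.linearIndependent_iff]
  intro c hc m
  -- The coefficients `c` become a multilinear form on coordinate vectors. It suffices to show that
  -- it vanishes on spanning vectors, which are values of functionals at points.
  let g : MultilinearMap 𝕜 (fun i => M (l i) → 𝕜) 𝕜 :=
    ∑ m, c m • (MultilinearMap.mkPiAlgebra 𝕜 (Fin N) 𝕜).compLinearMap fun i => LinearMap.proj (m i)
  have hg : ∀ v, g v = ∑ m, c m * ∏ i, v i (m i) := fun v => by simp [g]
  have hg0 : g = 0 := by
    refine MultilinearMap.ext_of_span_eq_top
      (fun i => (hφ (l i)).span_range_dual_eval_eq_top) fun p => ?_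
    let Λ : MultilinearMap 𝕜 (fun _ : Fin N => F) 𝕜 :=
      (MultilinearMap.mkPiAlgebra 𝕜 (Fin N) 𝕜).compLinearMap fun i => (p i).2
    have hbij : Function.Bijective (PiTensorProduct.lift τ) := hτ
    -- The universal property of the tensor power supplies the product of the functionals as a
    -- linear map on `E`; it is then applied to the relation `hc`.
    let T : E →ₗ[𝕜] 𝕜 :=
      PiTensorProduct.lift Λ ∘ₗ (LinearEquiv.ofBijective (PiTensorProduct.lift τ) hbij).symm
    have hT : ∀ w, T (τ w) = ∏ i, (p i).2 (w i) := fun w => by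
      have h1 : (LinearEquiv.ofBijective (PiTensorProduct.lift τ) hbij).symm (τ w) =
          PiTensorProduct.tprod 𝕜 w := by
        rw [LinearEquiv.symm_apply_eq, LinearEquiv.ofBijective_apply, PiTensorProduct.lift.tprod]
      simp only [T, LinearMap.comp_apply, LinearEquiv.coe_coe]
      rw [h1, PiTensorProduct.lift.tprod]
      simp [Λ]
    have h2 := congrArg T (congrFun hc fun i => (p i).1)
    simp only [Finset.sum_apply, Pi.smul_apply, map_sum, map_smul, tensorFun, hT, Pi.zero_apply,
      map_zero, smul_eq_mul] at h2
    rw [hg, zero_apply, ← h2]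
  -- At these unit vectors the form takes the value `c m`.
  have h3 := hg fun i => Pi.single (m i) 1
  rw [hg0, zero_apply, Finset.sum_eq_single m] at h3
  · simpa using h3.symm
  · intro m' _ hm'
    obtain ⟨i, hi⟩ := Function.ne_iff.1 hm'
    rw [Finset.prod_eq_zero (Finset.mem_univ i) (by simp [hi]), mul_zero]
  · simp

/-- A tensor product of linear combinations, in terms of the tensor products. -/
theorem map_sum_smul_univ (τ : MultilinearMap 𝕜 (fun _ : Fin N => F) E) {κ : Fin N → Type*}
    [∀ i, Fintype (κ i)] (a : ∀ i, κ i → 𝕜) (v : ∀ i, κ i → F) :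
    τ (fun i => ∑ m, a i m • v i m) = ∑ m : ∀ i, κ i, (∏ i, a i (m i)) • τ fun i => v i (m i) := by
  classical
  rw [MultilinearMap.map_sum]
  exact Finset.sum_congr rfl fun m _ => MultilinearMap.map_smul_univ _ _ _

/-- The tensor product space is spanned by the tensor products of the basis functions. -/
theorem tensorSpace_eq_span_range (τ : MultilinearMap 𝕜 (fun _ : Fin N => F) E)
    (φ : ∀ l, M l → Ω → F) (l : Fin N → ℒ) :
    tensorSpace τ φ l =
      Submodule.span 𝕜 (Set.range fun m : ∀ i, M (l i) => tensorFun τ fun i => φ (l i) (m i)) := by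
  apply le_antisymm
  · refine Submodule.span_le.2 ?_
    rintro u ⟨f, hf, rfl⟩
    simp only [Submodule.mem_span_range_iff_exists_fun] at hf
    choose a ha using hf
    refine (Submodule.mem_span_range_iff_exists_fun 𝕜).2 ⟨fun m => ∏ i, a i (m i), ?_⟩
    funext R
    have h1 : ∀ i, f i (R i) = ∑ m, a i m • φ (l i) m (R i) := fun i => by
      rw [← ha i]; simp [Finset.sum_apply]
    simp only [tensorFun, h1, map_sum_smul_univ, Finset.sum_apply, Pi.smul_apply]
  · refine Submodule.span_mono ?_
    rintro u ⟨m, rfl⟩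
    exact ⟨_, fun i => Submodule.subset_span ⟨m i, rfl⟩, rfl⟩

end TensorFunctions

/-! ### One-parameter groups -/

section OneParameterGroups

/-- A continuous one-parameter group in a Banach algebra is differentiable at `0`. -/
theorem differentiableAt_zero_of_continuous_of_map_add {R : Type*} [NormedRing R]
    [NormedAlgebra ℝ R] [CompleteSpace R] {u : ℝ → R} (hu : Continuous u) (h0 : u 0 = 1)
    (hadd : ∀ s t, u (s + t) = u s * u t) : DifferentiableAt ℝ u 0 := by
  -- The integral is differentiable and satisfies `u t * J a = J (t + a) - J t`. Once some `J a` is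
  -- invertible, `u` inherits differentiability.
  set J : ℝ → R := fun t => ∫ s in (0 : ℝ)..t, u s with hJ
  have hJd : ∀ t, HasDerivAt J (u t) t := fun t =>
    intervalIntegral.integral_hasDerivAt_right (hu.intervalIntegrable _ _)
      (hu.stronglyMeasurableAtFilter _ _) hu.continuousAt
  have hJt : ∀ a t, u t * J a = J (t + a) - J t := fun a t => by
    have h1 : u t * J a = ∫ s in (0 : ℝ)..a, u (t + s) := by
      simp only [hJ, hadd]
      exact ((ContinuousLinearMap.mul ℝ R (u t)).intervalIntegral_comp_comm
        (hu.intervalIntegrable _ _)).symm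
    rw [h1, intervalIntegral.integral_comp_add_left, add_zero]
    exact (intervalIntegral.integral_interval_sub_left (hu.intervalIntegrable _ _)
      (hu.intervalIntegrable _ _)).symm
  -- `J a / a` tends to `u 0 = 1` as `a → 0`, and the units are open.
  obtain ⟨a, ha⟩ : ∃ a, IsUnit (J a) := by
    have hslope := (hJd 0).tendsto_slope_zero
    have hJ0 : J 0 = 0 := by simp [hJ]
    rw [h0] at hslope
    have hev : ∀ᶠ t in nhdsWithin (0 : ℝ) {0}ᶜ, IsUnit (t⁻¹ • (J (0 + t) - J 0)) :=
      hslope.eventually (Units.isOpen.mem_nhds isUnit_one)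
    obtain ⟨a, ha, ha0⟩ := (hev.and self_mem_nhdsWithin).exists
    refine ⟨a, ?_⟩
    rw [zero_add, hJ0, sub_zero] at ha
    have hane : a ≠ 0 := ha0
    have := ha.smul (Units.mk0 a hane)
    simpa [Units.smul_def, smul_smul, hane] using this
  obtain ⟨v, hv⟩ := ha
  have hu' : u = fun t => (J (t + a) - J t) * (↑v⁻¹ : R) := by
    funext t
    rw [← hJt, ← hv, Units.mul_inv_cancel_right]
  rw [hu']
  have h1 : DifferentiableAt ℝ (fun t => J (t + a)) 0 :=
    ((hJd (0 + a)).comp_add_const 0 a).differentiableAt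
  exact (h1.sub (hJd 0).differentiableAt).mul_const _

variable {𝕜 ι : Type*} [RCLike 𝕜] [Fintype ι] [DecidableEq ι]

open scoped Matrix.Norms.Operator in
/-- The entries of a continuous one-parameter group of matrices are differentiable at `0`. -/
theorem Matrix.differentiableAt_zero_of_continuous_of_map_add {u : ℝ → Matrix ι ι 𝕜}
    (hu : Continuous u) (h0 : u 0 = 1) (hadd : ∀ s t, u (s + t) = u s * u t) (a b : ι) :
    DifferentiableAt ℝ (fun t => u t a b) 0 := by
  have h := _root_.differentiableAt_zero_of_continuous_of_map_add hu h0 hadd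
  exact (Matrix.entryLinearMap ℝ 𝕜 a b).toContinuousLinearMap.differentiableAt.comp 0 h

/-- A vector is fixed by a one-parameter group of matrices if and only if it is annihilated by
the derivative at `0`. -/
theorem Matrix.forall_mulVec_eq_iff_of_hasDerivAt {T : ℝ → Matrix ι ι 𝕜} {T' : Matrix ι ι 𝕜}
    (h0 : T 0 = 1) (hadd : ∀ s t, T (s + t) = T s * T t)
    (hT : ∀ a b, HasDerivAt (fun t => T t a b) (T' a b) 0) (c : ι → 𝕜) :
    (∀ t, (T t).mulVec c = c) ↔ T'.mulVec c = 0 := by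
  have hd0 : ∀ i, HasDerivAt (fun t => (T t).mulVec c i) (T'.mulVec c i) 0 := fun i => by
    simp only [Matrix.mulVec, dotProduct]
    exact HasDerivAt.fun_sum fun j _ => (hT i j).mul_const (c j)
  constructor
  · intro h
    funext i
    have h1 := hd0 i
    simp only [h] at h1
    exact h1.unique (hasDerivAt_const _ _)
  · intro h
    -- By the group law, the derivative of the orbit at `t` is `T t` applied to `T'.mulVec c`, which
    -- is zero; the orbit is therefore constant.
    have hd : ∀ i t, HasDerivAt (fun s => (T s).mulVec c i) 0 t := fun i t => by
      have h1 : HasDerivAt (fun s => (T (t + s)).mulVec c i) 0 0 := by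
        have h2 : ∀ s, (T (t + s)).mulVec c i = ∑ b, T t i b * (T s).mulVec c b := fun s => by
          rw [hadd, ← Matrix.mulVec_mulVec]; rfl
        simp only [h2]
        have h3 := HasDerivAt.fun_sum (u := Finset.univ)
          fun b (_ : b ∈ Finset.univ) => (hd0 b).const_mul (T t i b)
        simpa [h] using h3
      have h4 := HasDerivAt.comp_sub_const t t (f := fun s => (T (t + s)).mulVec c i) (f' := 0)
        (by rwa [sub_self])
      simpa using h4
    intro t
    funext i
    have := is_const_of_deriv_eq_zero (f := fun s => (T s).mulVec c i)
      (fun t => (hd i t).differentiableAt) (fun t => (hd i t).deriv) t 0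
    simpa [h0] using this

end OneParameterGroups

/-! ### Equivariant coupling -/

section Representations

variable {G Ω F κ 𝕜 : Type*} [Group G] [MulAction G Ω] [Field 𝕜] [AddCommGroup F] [Module 𝕜 F]
  [Fintype κ] {φ : κ → Ω → F}

/-- `compatibleRep` is an arbitrary choice of coefficients; independence makes the choice unique.
The group laws then follow by exhibiting coefficients that work. -/
theorem compatibleRep_eq_of_forall (hφ : LinearIndependent 𝕜 φ) (hst : IsGroupStable 𝕜 G φ)
    {g : G} {A : Matrix κ κ 𝕜} (hA : ∀ m r, φ m (g • r) = ∑ m', A m m' • φ m' r) :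
    compatibleRep 𝕜 φ g = A := by
  ext m m'
  have h : ∑ j, (compatibleRep 𝕜 φ g m j - A m j) • φ j = 0 := by
    funext r
    have := (compatibleRep_spec 𝕜 hst g m r).symm.trans (hA m r)
    simpa [Finset.sum_apply, sub_smul, sub_eq_zero] using this
  exact sub_eq_zero.1 (Fintype.linearIndependent_iff.1 hφ _ h m')

theorem compatibleRep_one [DecidableEq κ] (hφ : LinearIndependent 𝕜 φ) (hst : IsGroupStable 𝕜 G φ) :
    compatibleRep 𝕜 φ (1 : G) = 1 :=
  compatibleRep_eq_of_forall hφ hst fun m r => by simp [Matrix.one_apply]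

theorem compatibleRep_mul (hφ : LinearIndependent 𝕜 φ) (hst : IsGroupStable 𝕜 G φ) (g h : G) :
    compatibleRep 𝕜 φ (g * h) = compatibleRep 𝕜 φ g * compatibleRep 𝕜 φ h :=
  compatibleRep_eq_of_forall hφ hst fun m r => by
    rw [mul_smul, compatibleRep_spec 𝕜 hst]
    simp only [compatibleRep_spec 𝕜 hst h, Finset.smul_sum, smul_smul, Matrix.mul_apply,
      Finset.sum_smul]
    exact Finset.sum_comm

end Representations

/-! ### Intertwining matrices and the coupling matrix as a derivative -/

section Coupling

open scoped Kronecker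

variable {𝕜 ι : Type*} [Fintype ι] {κ : ι → Type*}

/-- The Kronecker product of a finite family of square matrices. -/
def piKronecker [CommRing 𝕜] (A : ∀ i, Matrix (κ i) (κ i) 𝕜) :
    Matrix (∀ i, κ i) (∀ i, κ i) 𝕜 :=
  Matrix.of fun m m' => ∏ i, A i (m i) (m' i)

theorem piKronecker_one [CommRing 𝕜] [∀ i, DecidableEq (κ i)] :
    piKronecker (fun i => (1 : Matrix (κ i) (κ i) 𝕜)) = 1 := by
  ext m m'
  simp [piKronecker, Matrix.one_apply, Finset.prod_ite_zero, funext_iff]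

theorem piKronecker_mul [CommRing 𝕜] [DecidableEq ι] [∀ i, Fintype (κ i)]
    (A B : ∀ i, Matrix (κ i) (κ i) 𝕜) :
    piKronecker (fun i => A i * B i) = piKronecker A * piKronecker B := by
  ext m m'
  simp [piKronecker, Matrix.mul_apply, Finset.prod_univ_sum, Finset.prod_mul_distrib]

variable {N : ℕ} {ℒ : Type*} {M : ℒ → Type*}

/-- The derivative at `0` of the action of a one-parameter group on coupling coefficients is the
matrix `couplingBlock`. -/
theorem hasDerivAt_kronecker_couplingBlock [RCLike 𝕜] [∀ l, DecidableEq (M l)]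
    {ρ : ∀ l, ℝ → Matrix (M l) (M l) 𝕜} {A : ∀ l, Matrix (M l) (M l) 𝕜} (h0 : ∀ l, ρ l 0 = 1)
    (hd : ∀ l a b, HasDerivAt (fun t => ρ l t a b) (A l a b) 0) (l : Fin N → ℒ) (L : ℒ)
    (p q : (∀ i, M (l i)) × M L) :
    HasDerivAt (fun t => ((piKronecker fun i => ρ (l i) t).transpose ⊗ₖ ρ L (-t)) p q)
      (couplingBlock A l L p q) 0 := by
  -- At `t = 0` all the other factors are identity entries, so the `j`-th term of the product rule
  -- survives only if the indices agree away from `j`. The transpose accounts for the order `(q.1 i)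
  -- (p.1 i)`.
  have h1 := HasDerivAt.fun_finsetProd (u := Finset.univ)
    fun i (_ : i ∈ Finset.univ) => hd (l i) (q.1 i) (p.1 i)
  have h2 : HasDerivAt (fun t => ρ L (-t) p.2 q.2) (-A L p.2 q.2) 0 := by
    have := HasDerivAt.scomp (0 : ℝ) (h := fun t : ℝ => -t) (by simpa using hd L p.2 q.2)
      (hasDerivAt_neg (0 : ℝ))
    simpa [Function.comp_def] using this
  have h3 := h1.mul h2
  simp only [h0, neg_zero, Matrix.one_apply, Finset.prod_boole] at h3
  refine (h3.congr_deriv ?_)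
  obtain ⟨m, k⟩ := p
  obtain ⟨m', k'⟩ := q
  simp only [couplingBlock, Matrix.of_apply]
  by_cases hm : m = m'
  · subst hm
    by_cases hk : k = k'
    · subst hk; simp [sub_eq_add_neg]
    · simp [hk]
  · have hne : ¬ ∀ i, m' i = m i := fun h => hm (funext fun i => (h i).symm)
    simp only [hm, false_and, if_false, Finset.mem_univ, true_implies, hne, zero_mul, add_zero,
      Finset.sum_mul]
    refine Finset.sum_congr rfl fun j _ => ?_
    -- Since `m ≠ m'`, agreement away from `j` already forces disagreement at `j`.
    have hiff : (∀ s, s ≠ j → m s = m' s) ∧ m j ≠ m' j ∧ k = k' ↔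
        (∀ i ∈ Finset.univ.erase j, m' i = m i) ∧ k = k' := by
      constructor
      · rintro ⟨ha, -, hb⟩
        exact ⟨fun i hi => (ha i (Finset.ne_of_mem_erase hi)).symm, hb⟩
      · rintro ⟨ha, hb⟩
        have ha' : ∀ s, s ≠ j → m s = m' s := fun s hs =>
          (ha s (Finset.mem_erase.2 ⟨hs, Finset.mem_univ s⟩)).symm
        refine ⟨ha', fun hj => hm (funext fun s => ?_), hb⟩
        by_cases hs : s = j
        · subst hs; exact hj
        · exact ha' s hs
    rw [if_congr hiff rfl rfl, ite_and]
    split_ifs <;> simp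

variable [∀ l, Fintype (M l)]

/-- The coefficients that intertwine a one-parameter group of matrices are the kernel of
`couplingBlock`. -/
theorem forall_intertwine_iff_couplingBlock_mulVec_eq_zero [RCLike 𝕜]
    [∀ l, DecidableEq (M l)] {ρ : ∀ l, ℝ → Matrix (M l) (M l) 𝕜}
    {A : ∀ l, Matrix (M l) (M l) 𝕜} (h0 : ∀ l, ρ l 0 = 1)
    (hadd : ∀ l s t, ρ l (s + t) = ρ l s * ρ l t)
    (hd : ∀ l a b, HasDerivAt (fun t => ρ l t a b) (A l a b) 0) (l : Fin N → ℒ) (L : ℒ)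
    (C : Matrix (M L) (∀ i, M (l i)) 𝕜) :
    (∀ t, C * piKronecker (fun i => ρ (l i) t) = ρ L t * C) ↔
      (couplingBlock A l L).mulVec C.vec = 0 := by
  rw [← Matrix.forall_mulVec_eq_iff_of_hasDerivAt
    (T := fun t => (piKronecker fun i => ρ (l i) t).transpose ⊗ₖ ρ L (-t))
    (by simp [h0, piKronecker_one]) (fun s t => ?_)
    (hasDerivAt_kronecker_couplingBlock h0 hd l L)]
  · refine forall_congr' fun t => ?_
    have hinv : ∀ s, ρ L s * ρ L (-s) = 1 := fun s => by rw [← hadd, add_neg_cancel, h0]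
    have hinv' : ∀ s, ρ L (-s) * ρ L s = 1 := fun s => by rw [← hadd, neg_add_cancel, h0]
    -- The fixed-vector condition unfolds to `ρ L (-t) * (C * P) = C` with `P` the Kronecker product
    -- at `t`; multiplying by `ρ L t` turns it into the intertwining relation.
    rw [Matrix.kronecker_mulVec_vec, Matrix.transpose_transpose, Matrix.vec_inj, Matrix.mul_assoc]
    constructor
    · intro h; rw [h, ← Matrix.mul_assoc, hinv', Matrix.one_mul]
    · intro h; nth_rw 2 [← h]; rw [← Matrix.mul_assoc, hinv, Matrix.one_mul]
  -- Transposition reverses the order of the factors, which is harmless because `s + t = t + s`.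
  · rw [← Matrix.mul_kronecker_mul, ← Matrix.transpose_mul, ← piKronecker_mul, ← hadd, add_comm s t]
    simp only [hadd, neg_add_rev]

/-! ### Coupled functions and their coefficient matrices -/

section CoupledFunctions

variable [Field 𝕜] {F E Ω : Type*} [AddCommGroup F] [Module 𝕜 F] [AddCommGroup E] [Module 𝕜 E]
  {τ : MultilinearMap 𝕜 (fun _ : Fin N => F) E} {φ : ∀ l, M l → Ω → F}

/-- `coupledFun` as a linear map of the coefficients. -/
def coupledLinearMap (τ : MultilinearMap 𝕜 (fun _ : Fin N => F) E) (φ : ∀ l, M l → Ω → F)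
    (l : Fin N → ℒ) (κ : Type*) [Fintype κ] :
    ((∀ i, M (l i)) × κ → 𝕜) →ₗ[𝕜] (Fin N → Ω) → κ → E where
  toFun := coupledFun τ φ l
  map_add' c c' := by
    funext R k
    simp [coupledFun, add_smul, Finset.sum_add_distrib]
  map_smul' a c := by
    funext R k
    simp [coupledFun, mul_smul, Finset.smul_sum]

theorem coupledLinearMap_injective (hτ : IsTensorPower τ) (hφ : ∀ l, LinearIndependent 𝕜 (φ l))
    (l : Fin N → ℒ) (κ : Type*) [Fintype κ] : Function.Injective (coupledLinearMap τ φ l κ) := by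
  rw [injective_iff_map_eq_zero]
  intro c hc
  funext ⟨m, k⟩
  refine Fintype.linearIndependent_iff.1 (linearIndependent_tensorFun hτ hφ l)
    (fun m => c (m, k)) ?_ m
  funext R
  have := congrFun (congrFun hc R) k
  simpa [coupledLinearMap, coupledFun, Finset.sum_apply] using this

theorem exists_coupledFun_eq {l : Fin N → ℒ} {κ : Type*} [Fintype κ] {u : (Fin N → Ω) → κ → E}
    (hu : ∀ k, (fun R => u R k) ∈ tensorSpace τ φ l) : ∃ c, coupledFun τ φ l c = u := by
  simp only [tensorSpace_eq_span_range, Submodule.mem_span_range_iff_exists_fun] at hu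
  choose a ha using hu
  refine ⟨fun p => a p.2 p.1, ?_⟩
  funext R k
  have := congrFun (ha k) R
  simpa [coupledFun, Finset.sum_apply] using this

theorem coupledFun_mem_tensorSpace (l : Fin N → ℒ) {κ : Type*} [Fintype κ]
    (c : (∀ i, M (l i)) × κ → 𝕜) (k : κ) :
    (fun R => coupledFun τ φ l c R k) ∈ tensorSpace τ φ l := by
  rw [tensorSpace_eq_span_range, Submodule.mem_span_range_iff_exists_fun]
  exact ⟨fun m => c (m, k), by funext R; simp [coupledFun, Finset.sum_apply]⟩

/-- A coupled function is equivariant if and only if its coefficients intertwine the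
representations. -/
theorem isGroupEquivariant_coupledFun_iff {G : Type*} [Group G] [MulAction G Ω]
    (hτ : IsTensorPower τ) (hφ : ∀ l, LinearIndependent 𝕜 (φ l))
    (hst : ∀ l, IsGroupStable 𝕜 G (φ l)) (l : Fin N → ℒ) {κ : Type*} [Fintype κ]
    (ρ : G → Matrix κ κ 𝕜) (C : Matrix κ (∀ i, M (l i)) 𝕜) :
    IsGroupEquivariant ρ (coupledFun τ φ l C.vec) ↔
      ∀ g, C * piKronecker (fun i => compatibleRep 𝕜 (φ (l i)) g) = ρ g * C := by
  refine forall_congr' fun g => ?_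
  have hl : ∀ R k, coupledFun τ φ l C.vec (fun i => g • R i) k = coupledFun τ φ l
      (C * piKronecker fun i => compatibleRep 𝕜 (φ (l i)) g).vec R k := fun R k => by
    simp only [coupledFun, tensorFun, compatibleRep_spec 𝕜 (hst _) g, map_sum_smul_univ,
      Matrix.vec, Matrix.mul_apply, Finset.smul_sum, Finset.sum_smul, smul_smul]
    exact Finset.sum_comm
  have hr : ∀ R k, ∑ k', ρ g k k' • coupledFun τ φ l C.vec R k' =
      coupledFun τ φ l (ρ g * C).vec R k := fun R k => by
    simp only [coupledFun, Matrix.vec, Matrix.mul_apply, Finset.smul_sum, Finset.sum_smul,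
      smul_smul]
    exact Finset.sum_comm
  simp only [hl, hr]
  -- Both sides of the equivariance condition are now coupled functions, so injectivity reduces it
  -- to equality of coefficient matrices.
  rw [← Matrix.vec_inj, ← (coupledLinearMap_injective hτ hφ l κ).eq_iff]
  exact ⟨fun h => funext fun R => funext fun k => h R k, fun h R k => congrFun (congrFun h R) k⟩

end CoupledFunctions

end Coupling

theorem mainTheorem2 {𝕜 : Type*} [RCLike 𝕜]
    -- a connected linear Lie group and generators of its Lie algebra
    {n D : ℕ} (G : Subgroup (GL (Fin n) ℂ)) (hG : IsLinearLieGroup G)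
    (hconn : IsConnected (G : Set (GL (Fin n) ℂ)))
    (X : Fin D → lieAlgebraOf G) (hX : IsLieAlgebraBasis X)
    -- the domain with its group action, and the vector space of values
    {Ω : Type*} [MulAction G Ω] {F : Type*} [AddCommGroup F] [Module 𝕜 F]
    -- the orthonormal, group-stable one-particle functions, with continuous representations
    {ℒ : Type*} {M : ℒ → Type*} [∀ l, Fintype (M l)] [∀ l, DecidableEq (M l)]
    (H : Submodule 𝕜 (Ω → F)) (ip : PreInnerProductSpace.Core 𝕜 H)
    (φ : ∀ l, M l → H) (hφ : IsOrthonormalFamily ip φ)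
    (hstable : ∀ l, IsGroupStable 𝕜 G (fun m => (φ l m : Ω → F)))
    (hcont : ∀ l, Continuous fun g : G => compatibleRep 𝕜 (fun m => (φ l m : Ω → F)) g)
    -- the `N`-th tensor power of `F`, the space of values of the `N`-particle functions
    {N : ℕ} {E : Type*} [AddCommGroup E] [Module 𝕜 E]
    (τ : MultilinearMap 𝕜 (fun _ : Fin N => F) E) (hτ : IsTensorPower τ)
    (l : Fin N → ℒ) (L : ℒ) :
    let f : ∀ l, M l → Ω → F := fun l m => φ l m
    let ρ : ∀ l, G → Matrix (M l) (M l) 𝕜 := fun l => compatibleRep 𝕜 (f l)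
    let A : Fin D → ∀ l, Matrix (M l) (M l) 𝕜 := fun d l => lieDeriv (ρ l) (X d)
    let K : Submodule 𝕜 ((∀ i, M (l i)) × M L → 𝕜) :=
      LinearMap.ker (couplingMatrix A l L).mulVecLin
    let V : Submodule 𝕜 ((Fin N → Ω) → M L → E) := geSpace τ f l (ρ L)
    -- the derivatives that define the matrix exist
    (∀ (d : Fin D) (l' : ℒ) (a b : M l'),
      DifferentiableAt ℝ (fun t : ℝ => ρ l' (oneParam (X d) t) a b) 0) ∧
    -- the coefficients of equivariant functions are the kernel of the matrix
    (∀ c : (∀ i, M (l i)) × M L → 𝕜, coupledFun τ f l c ∈ V ↔ c ∈ K) ∧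
    -- a basis of the kernel gives a basis of the space of equivariant functions
    (∀ c : Module.Basis (Fin (Module.finrank 𝕜 K)) 𝕜 K,
      ∃ b : Module.Basis (Fin (Module.finrank 𝕜 K)) 𝕜 V,
        ∀ i, (b i : (Fin N → Ω) → M L → E) =
          coupledFun τ f l (c i : (∀ i, M (l i)) × M L → 𝕜)) ∧
    Module.finrank 𝕜 V = Module.finrank 𝕜 K := by
  intro f ρ A K V
  have hli : ∀ l, LinearIndependent 𝕜 (f l) := fun l => hφ.linearIndependent l
  have hone : ∀ l, ρ l 1 = 1 := fun l => compatibleRep_one (hli l) (hstable l)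
  have hmul : ∀ l g h, ρ l (g * h) = ρ l g * ρ l h := fun l g h =>
    compatibleRep_mul (hli l) (hstable l) g h
  have h0 : ∀ d l, ρ l (oneParam (X d) 0) = 1 := fun d l => by rw [oneParam_zero, hone]
  have hadd : ∀ d l s t,
      ρ l (oneParam (X d) (s + t)) = ρ l (oneParam (X d) s) * ρ l (oneParam (X d) t) :=
    fun d l s t => by rw [oneParam_add, hmul]
  have hdiff : ∀ (d : Fin D) (l' : ℒ) (a b : M l'),
      DifferentiableAt ℝ (fun t : ℝ => ρ l' (oneParam (X d) t) a b) 0 := fun d l' =>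
    Matrix.differentiableAt_zero_of_continuous_of_map_add
      ((hcont l').comp (continuous_oneParam (X d))) (h0 d l') (hadd d l')
  have hiff : ∀ c : (∀ i, M (l i)) × M L → 𝕜, coupledFun τ f l c ∈ V ↔ c ∈ K := by
    intro c
    obtain ⟨C, rfl⟩ : ∃ C : Matrix (M L) (∀ i, M (l i)) 𝕜, C.vec = c :=
      ⟨Matrix.of fun k m => c (m, k), rfl⟩
    have hV : coupledFun τ f l C.vec ∈ V ↔
        ∀ g, C * piKronecker (fun i => ρ (l i) g) = ρ L g * C :=
      (and_iff_right (coupledFun_mem_tensorSpace l C.vec)).trans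
        (isGroupEquivariant_coupledFun_iff hτ hli hstable l (ρ L) C)
    have hK : C.vec ∈ K ↔ ∀ d, (couplingBlock (A d) l L).mulVec C.vec = 0 :=
      ⟨fun h d => funext fun p => congrFun h (d, p), fun h => funext fun p => congrFun (h p.1) p.2⟩
    have hblock : ∀ d, (∀ t, C * piKronecker (fun i => ρ (l i) (oneParam (X d) t)) =
        ρ L (oneParam (X d) t) * C) ↔ (couplingBlock (A d) l L).mulVec C.vec = 0 := fun d =>
      forall_intertwine_iff_couplingBlock_mulVec_eq_zero (ρ := fun l t => ρ l (oneParam (X d) t))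
        (h0 d) (hadd d) (fun l a b => (hdiff d l a b).hasDerivAt) l L C
    rw [hV, hK]
    refine ⟨fun h d => (hblock d).1 fun t => h _, fun h => ?_⟩
    have hPmul : ∀ g h, piKronecker (fun i => ρ (l i) (g * h)) =
        piKronecker (fun i => ρ (l i) g) * piKronecker (fun i => ρ (l i) h) := fun g h => by
      rw [← piKronecker_mul]; simp only [hmul]
    have hPone : piKronecker (fun i => ρ (l i) 1) = 1 := by simp only [hone, piKronecker_one]
    -- The elements intertwined by `C` form a subgroup, so the one-parameter subgroups of the basis
    -- decide whether it is all of `G`.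
    let S : Subgroup G :=
      { carrier := {g | C * piKronecker (fun i => ρ (l i) g) = ρ L g * C}
        one_mem' := by rw [Set.mem_ofPred_eq, hPone, hone, Matrix.mul_one, Matrix.one_mul]
        mul_mem' := fun {g h} hg hh => by
          simp only [Set.mem_ofPred_eq] at hg hh ⊢
          rw [hPmul, hmul, ← Matrix.mul_assoc, hg, Matrix.mul_assoc, hh, Matrix.mul_assoc]
        inv_mem' := fun {g} hg => by
          simp only [Set.mem_ofPred_eq] at hg ⊢
          have h1 : C = ρ L g⁻¹ * (C * piKronecker (fun i => ρ (l i) g)) := by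
            rw [hg, ← Matrix.mul_assoc, ← hmul, inv_mul_cancel, hone, Matrix.one_mul]
          nth_rw 1 [h1]
          rw [Matrix.mul_assoc, Matrix.mul_assoc, ← hPmul, mul_inv_cancel, hPone, Matrix.mul_one] }
    have hS : S = ⊤ := eq_top_of_oneParam_mem hG hconn hX S fun d t => (hblock d).2 (h d) t
    intro g
    exact hS.ge (Subgroup.mem_top g)
  -- By `hiff`, the coefficient map restricts to an isomorphism from the kernel to the equivariant
  -- functions; it transports bases and dimension.
  let T : K →ₗ[𝕜] V := (coupledLinearMap τ f l (M L)).restrict fun c hc => (hiff c).2 hc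
  have hT : Function.Bijective T := by
    refine ⟨fun c c' h => Subtype.ext (coupledLinearMap_injective hτ hli l (M L)
      (congrArg Subtype.val h)), fun u => ?_⟩
    obtain ⟨c, hc⟩ := exists_coupledFun_eq u.2.1
    exact ⟨⟨c, (hiff c).1 (hc ▸ u.2)⟩, Subtype.ext hc⟩
  let e : K ≃ₗ[𝕜] V := LinearEquiv.ofBijective T hT
  refine ⟨hdiff, hiff, fun c => ⟨c.map e, fun i => ?_⟩, e.symm.finrank_eq⟩
  rw [Module.Basis.map_apply]
  rfl
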